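/- **Definitions.** Let $\mathbb N=\{1,2,3,\dots\}$. For families $\mathcal F,\mathcal G$ of finite subsets of $\mathbb N$ let $\mathcal F[\mathcal G]$ be the family of all unions $G_1\cup\dots\cup G_n$ of nonempty sets $G_1<\dots<G_n$ (that is, $\max G_i<\min G_{i+1}$) in $\mathcal G$ with $\{\min G_1,\dots,\min G_n\}\in\mathcal F$; here $n=0$ is allowed and gives $\varnothing$ if $\varnothing\in\mathcal F$. For every countable limit ordinal $\xi$ fix an arbitrary nondecreasing sequence of ordinals $\xi_n<\xi$ with $\sup_n\xi_n=\xi$. The Schreier families $\mathcal S_\xi$, $\xi<\omega_1$, are $$\mathcal S_0=\{\varnothing\}\cup\{\{n\}: n\in\mathbb N\},\qquad \mathcal S_{\xi+1}=\mathcal S_1[\mathcal S_\xi],\quad\text{where } \mathcal S_1=\{\varnothing\}\cup\{F\subseteq\mathbb N \text{ finite}: \#F\le\min F\},$$ and, for a limit ordinal $\xi$, $\mathcal S_\xi=\{F: n\le \min F\text{ and }F\in\mathcal S_{\xi_n}\text{ for some }n\in\mathbb N\}$ (with $\varnothing\in\mathcal S_\xi$). Let $X,Y$ be Banach spaces over $\mathbb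 R$ or over $\mathbb C$, let $\mathcal L(X,Y)$ be the space of bounded linear operators, and let $T\in\mathcal L(X,Y)$. * $T\in\mathcal{SS}(X,Y)$ (strictly singular) if for every infinite-dimensional subspace $Z\subseteq X$ and every $\varepsilon>0$ there is $z\in Z$ with $\|Tz\|<\varepsilon\|z\|$. * $T\in\mathcal{FSS}(X,Y)$ (finitely strictly singular) if for every $\varepsilon>0$ there is $n\in\mathbb N$ such that every subspace $Z\subseteq X$ with $\dim Z\ge n$ contains some $z$ with $\|Tz\|<\varepsilon\|z\|$. * For $1\le\xi<\omega_1$, $T\in\mathcal{SS}_\xi(X,Y)$ ($\mathcal S_\xi$-strictly singular) if for every $\varepsilon>0$ and every basic sequence $(x_n)_{n\in\mathbb N}$ in $X$ (that is, a sequence which is a Schauder basis of its closed linear span) there are $F\in\mathcal S_\xi$ and a nonzero $z$ in the linear span of $\{x_i: i\in F\}$ with $\|Tz\|\le\varepsilon\|z\|$. Write $\mathcal L(X)=\mathcal L(X,X)$ and $\mathcal{SS}_\xi(X)=\mathcal{SS}_\xi(X,X)$. **Proposition.** Let $X$ and $Y$ be Banach spaces over the same scalar field ($\mathbb R$ or $\mathbb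 C$) and let $1\le\xi,\zeta<\omega_1$. Then: 1. $\mathcal{FSS}(X,Y)\subseteq\mathcal{SS}_\xi(X,Y)\subseteq\mathcal{SS}(X,Y)$. 2. If $\xi<\zeta$, then $\mathcal{SS}_\xi(X,Y)\subseteq\mathcal{SS}_\zeta(X,Y)$. 3. $\mathcal{SS}_\xi(X)$ is closed in $\mathcal L(X)$ for the operator norm. 4. If $S\in\mathcal{SS}_\xi(X)$ and $T\in\mathcal L(X)$, then $TS\in\mathcal{SS}_\xi(X)$ and $ST\in\mathcal{SS}_\xi(X)$. 5. If $S\in\mathcal{SS}_\xi(X)$ and $T\in\mathcal{SS}_\zeta(X)$, then $S+T\in\mathcal{SS}_{\xi+\zeta}(X)$. In particular, if $S,T\in\mathcal{SS}_\xi(X)$, then $S+T\in\mathcal{SS}_{\xi\cdot2}(X)$. -/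

import Mathlib

open Filter Topology
open scoped Ordinal Cardinal

/-!
Conventions.  Schreier families live on the positive integers `{1, 2, 3, …}`.  Sequences and families
of finite sets are indexed here by Lean's `ℕ = {0, 1, 2, …}`, and the Lean index `i` stands for the positive integer `i + 1`
throughout (for elements of finite sets, for terms of sequences of vectors, and for terms of
sequences of ordinals).
-/

/-- The family of all finite sets `F` with `#F ≤ min F`, together with `∅`
(the index `i` stands for the positive integer `i + 1`). -/
def schreierOne : Set (Finset ℕ) :=
  {F | ∀ i ∈ F, F.card ≤ i + 1}

/-- The family `A[B]` of all unions `G₁ ∪ ⋯ ∪ Gₙ` with `G₁ < ⋯ < Gₙ` nonempty members of `B`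
such that `{min G₁, …, min Gₙ} ∈ A`. The case `n = 0` contributes `∅` (when `∅ ∈ A`). -/
def familyComp (A B : Set (Finset ℕ)) : Set (Finset ℕ) :=
  {E | ∃ (n : ℕ) (G : Fin n → Finset ℕ) (hG : ∀ i, (G i).Nonempty),
    (∀ i, G i ∈ B) ∧
    (∀ i j, i < j → ∀ a ∈ G i, ∀ b ∈ G j, a < b) ∧
    Finset.univ.image (fun i => (G i).min' (hG i)) ∈ A ∧
    E = Finset.univ.biUnion G}

/-- `φ` fixes, for every countable limit ordinal `ξ`, a sequence `φ ξ 0 ≤ φ ξ 1 ≤ ⋯` of ordinals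
smaller than `ξ` increasing to `ξ`.  (Values of `φ` at other ordinals are irrelevant.) -/
def IsLadderSystem (φ : Ordinal.{0} → ℕ → Ordinal.{0}) : Prop :=
  ∀ ξ : Ordinal.{0}, Order.IsSuccLimit ξ → ξ < ω₁ →
    Monotone (φ ξ) ∧ (∀ n, φ ξ n < ξ) ∧ IsLUB (Set.range (φ ξ)) ξ

/-- The Schreier families `𝒮_ξ` built from the chosen sequences `φ`:
* `𝒮_0` consists of `∅` and the singletons,
* `𝒮_{ξ+1} = 𝒮_1[𝒮_ξ]`,
* for a limit `ξ` with chosen sequence `ξ_n = φ ξ n`, a set `F` belongs to `𝒮_ξ` iff `n ≤ F` and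
  `F ∈ 𝒮_{ξ_n}` for some `n`.

The clause `φ ξ n < ξ` holds automatically for ladder systems; it makes the recursion legitimate. -/
noncomputable def schreierFamily (φ : Ordinal.{0} → ℕ → Ordinal.{0}) (ξ : Ordinal.{0}) :
    Set (Finset ℕ) :=
  Ordinal.limitRecOn (motive := fun _ => Set (Finset ℕ)) ξ
    {F | F = ∅ ∨ ∃ n, F = {n}}
    (fun _ 𝒮 => familyComp schreierOne 𝒮)
    (fun ξ _ 𝒮 => {F | ∃ (n : ℕ) (h : φ ξ n < ξ), (∀ i ∈ F, n ≤ i) ∧ F ∈ 𝒮 (φ ξ n) h})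

theorem schreierFamily_zero (φ : Ordinal.{0} → ℕ → Ordinal.{0}) :
    schreierFamily φ 0 = {F | F = ∅ ∨ ∃ n, F = {n}} := by
  simp [schreierFamily]

theorem schreierFamily_add_one (φ : Ordinal.{0} → ℕ → Ordinal.{0}) (ξ : Ordinal.{0}) :
    schreierFamily φ (ξ + 1) = familyComp schreierOne (schreierFamily φ ξ) := by
  simp [schreierFamily]

theorem schreierFamily_limit {φ : Ordinal.{0} → ℕ → Ordinal.{0}} (hφ : IsLadderSystem φ)
    {ξ : Ordinal.{0}} (hξ : Order.IsSuccLimit ξ) (hξ' : ξ < ω₁) :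
    schreierFamily φ ξ = {F | ∃ n : ℕ, (∀ i ∈ F, n ≤ i) ∧ F ∈ schreierFamily φ (φ ξ n)} := by
  have h := (hφ ξ hξ hξ').2.1
  ext F
  simp [schreierFamily, Ordinal.limitRecOn_limit _ _ _ _ hξ, h]

/-- The recursion gives the classical family `𝒮_1 = {F : #F ≤ min F}` at `ξ = 1`. -/
theorem schreierFamily_one (φ : Ordinal.{0} → ℕ → Ordinal.{0}) :
    schreierFamily φ 1 = schreierOne := by
  have h1 : (1 : Ordinal.{0}) = 0 + 1 := by simp
  rw [h1, schreierFamily_add_one, schreierFamily_zero]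
  ext F
  constructor
  · rintro ⟨n, G, hG, hB, -, hA, rfl⟩
    have hs : ∀ i, G i = {(G i).min' (hG i)} := by
      intro i
      rcases hB i with h | ⟨m, hm⟩
      · exact absurd h (hG i).ne_empty
      · simp [hm]
    have : Finset.univ.biUnion G = Finset.univ.image (fun i => (G i).min' (hG i)) := by
      ext a
      simp only [Finset.mem_biUnion, Finset.mem_univ, true_and, Finset.mem_image]
      refine exists_congr fun i => ?_
      conv_lhs => rw [hs i]
      rw [Finset.mem_singleton, eq_comm]
    rw [this]
    exact hA
  · intro hF
    refine ⟨F.card, fun i => {F.orderEmbOfFin rfl i}, fun i => by simp, fun i => by simp, ?_, ?_, ?_⟩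
    · intro i j hij a ha b hb
      simp only [Finset.mem_singleton] at ha hb
      subst ha hb
      exact (F.orderEmbOfFin rfl).strictMono hij
    · simpa using hF
    · ext a
      have := Finset.range_orderEmbOfFin F rfl
      have h2 : a ∈ F ↔ a ∈ Set.range (F.orderEmbOfFin rfl) := by rw [this]; simp
      rw [h2]
      simp only [Set.mem_range, Finset.mem_biUnion, Finset.mem_univ, true_and,
        Finset.mem_singleton]
      exact exists_congr fun i => eq_comm

section operators

variable {𝕜 : Type*} [RCLike 𝕜]
variable {X : Type*} [NormedAddCommGroup X] [NormedSpace 𝕜 X]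
variable {Y : Type*} [NormedAddCommGroup Y] [NormedSpace 𝕜 Y]

/-- `x` is a basic sequence: it is a Schauder basis of its closed linear span. -/
def IsBasicSequence (𝕜 : Type*) [RCLike 𝕜] {X : Type*} [NormedAddCommGroup X] [NormedSpace 𝕜 X]
    (x : ℕ → X) : Prop :=
  ∃ b : SchauderBasis 𝕜 (Submodule.span 𝕜 (Set.range x)).topologicalClosure,
    ∀ n, (b n : X) = x n

/-- `T` is strictly singular: it is bounded below on no infinite-dimensional subspace. -/
def IsStrictlySingular (T : X →L[𝕜] Y) : Prop :=
  ∀ Z : Submodule 𝕜 X, ¬ FiniteDimensional 𝕜 Z →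
    ∀ ε : ℝ, 0 < ε → ∃ z ∈ Z, ‖T z‖ < ε * ‖z‖

/-- `T` is finitely strictly singular: for every `ε > 0` there is `n` such that every subspace of
(possibly infinite) dimension at least `n` contains some `z` with `‖T z‖ < ε ‖z‖`. -/
def IsFinitelyStrictlySingular (T : X →L[𝕜] Y) : Prop :=
  ∀ ε : ℝ, 0 < ε → ∃ n : ℕ, ∀ Z : Submodule 𝕜 X, (n : Cardinal) ≤ Module.rank 𝕜 Z →
    ∃ z ∈ Z, ‖T z‖ < ε * ‖z‖

/-- `T` is `𝒮_ξ`-strictly singular.  As `F` is finite, the span of `{x i : i ∈ F}` is closed. -/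
def IsSchreierSingular (φ : Ordinal.{0} → ℕ → Ordinal.{0}) (ξ : Ordinal.{0})
    (T : X →L[𝕜] Y) : Prop :=
  ∀ ε : ℝ, 0 < ε → ∀ x : ℕ → X, IsBasicSequence 𝕜 x →
    ∃ F ∈ schreierFamily φ ξ, ∃ z ∈ Submodule.span 𝕜 (x '' (F : Set ℕ)),
      z ≠ 0 ∧ ‖T z‖ ≤ ε * ‖z‖

end operators

/-- The class `SS(X, Y)`. -/
def strictlySingular (𝕜 X Y : Type*) [RCLike 𝕜] [NormedAddCommGroup X] [NormedSpace 𝕜 X]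
    [NormedAddCommGroup Y] [NormedSpace 𝕜 Y] : Set (X →L[𝕜] Y) :=
  {T | IsStrictlySingular T}

/-- The class `FSS(X, Y)`. -/
def finitelyStrictlySingular (𝕜 X Y : Type*) [RCLike 𝕜] [NormedAddCommGroup X] [NormedSpace 𝕜 X]
    [NormedAddCommGroup Y] [NormedSpace 𝕜 Y] : Set (X →L[𝕜] Y) :=
  {T | IsFinitelyStrictlySingular T}

/-- The class `SS_ξ(X, Y)`. -/
def schreierSingular (φ : Ordinal.{0} → ℕ → Ordinal.{0}) (ξ : Ordinal.{0})
    (𝕜 X Y : Type*) [RCLike 𝕜] [NormedAddCommGroup X] [NormedSpace 𝕜 X]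
    [NormedAddCommGroup Y] [NormedSpace 𝕜 Y] : Set (X →L[𝕜] Y) :=
  {T | IsSchreierSingular φ ξ T}

/-!
The proof rests on two facts.

*Combinatorics.* The families `𝒮_ξ` are closed under spreading, a member of `𝒮_α` that starts late
enough lies in `𝒮_β` for `α ≤ β` (`exists_forall_mem_schreierFamily_of_le`), and unions of sets
`G₀ < G₁ < ⋯` that start late enough obey `𝒮_ζ[𝒮_ξ] ⊆ 𝒮_{ξ+ζ}` and, for sets `G_k` of at most two
elements, `𝒮_ζ[pairs] ⊆ 𝒮_ζ` (`substitutesInto_schreierFamily_add` and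
`substitutesInto_schreierFamily_pairs`). Both inclusions are proved by induction on `ζ`; at a limit,
`F ∈ 𝒮_ζ` lies in some `𝒮_{ζ_n}` with `n ≤ F`, so a diagonal choice of "late enough" works.

*Basic sequences.* Grunblum's criterion (`IsBasicSequence.exists_grunblumWith` and
`GrunblumWith.isBasicSequence`) shows that block sequences of basic sequences are basic, and Mazur's
construction (`exists_isBasicSequence_comp`) produces basic sequences from vectors nearly annihilated
by finitely many functionals.

Let `x` be a basic sequence. Tails of `x` are basic, so the first fact gives the monotonicity in `ξ`,
and `ℱ𝒮𝒮 ⊆ 𝒮𝒮_ξ` holds because `𝒮_ξ` contains sets of every size. Mazur's construction inside an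
infinite-dimensional subspace gives `𝒮𝒮_ξ ⊆ 𝒮𝒮`. For a sum `S + T`, choose a block sequence `z` of
`x`, with supports in `𝒮_ξ`, on whose terms `S` is summably small; then `S` is small on the whole
span of `z`, and `T` is small on some vector of the span of `{z k : k ∈ F}`, `F ∈ 𝒮_ζ`, whose
support lies in `𝒮_{ξ+ζ}`.

The delicate point is `S ∘ T`, since the images `T (x n)` need not have a basic subsequence. With
`x` normalized, either `T` is small on some difference `x p - x q`, which is then a vector as
required, or the differences `T (x p - x q)` are bounded below. As finitely many functionals are
nearly constant on a subsequence of the bounded sequence `T (x n)`, Mazur's construction then yields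
successive pairs whose differences `T (x p - x q)` form a basic sequence. A vector on which `S` is
small in the span of that sequence is the image of a vector whose support is a union of pairs, and
that support still belongs to `𝒮_ξ`.
-/

/-! ### Combinatorics of the Schreier families -/

/-- Since the minima of successive sets are distinct, membership in `𝒮₁[B]` only says that the number
of pieces is at most (the positive integer represented by) every element of every piece. -/
theorem mem_familyComp_schreierOne {B : Set (Finset ℕ)} {E : Finset ℕ} :
    E ∈ familyComp schreierOne B ↔ ∃ (n : ℕ) (G : Fin n → Finset ℕ),
      (∀ i, (G i).Nonempty) ∧ (∀ i, G i ∈ B) ∧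
      (∀ i j, i < j → ∀ a ∈ G i, ∀ b ∈ G j, a < b) ∧
      (∀ i, ∀ a ∈ G i, n ≤ a + 1) ∧ E = Finset.univ.biUnion G := by
  constructor
  · rintro ⟨n, G, hG, hB, hlt, hS, rfl⟩
    refine ⟨n, G, hG, hB, hlt, fun i a ha => ?_, rfl⟩
    have hinj : Function.Injective fun i => (G i).min' (hG i) := by
      refine StrictMono.injective (fun i j hij => ?_)
      exact hlt i j hij _ (Finset.min'_mem _ _) _ (Finset.min'_mem _ _)
    have h := hS ((G i).min' (hG i)) (Finset.mem_image_of_mem _ (Finset.mem_univ i))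
    rw [Finset.card_image_of_injective _ hinj, Finset.card_univ, Fintype.card_fin] at h
    have := Finset.min'_le (G i) a ha
    omega
  · rintro ⟨n, G, hG, hB, hlt, hn, rfl⟩
    refine ⟨n, G, hG, hB, hlt, fun a ha => ?_, rfl⟩
    obtain ⟨i, -, rfl⟩ := Finset.mem_image.1 ha
    refine Finset.card_image_le.trans ?_
    simpa using hn i _ (Finset.min'_mem _ (hG i))

theorem subset_familyComp_schreierOne (B : Set (Finset ℕ)) : B ⊆ familyComp schreierOne B := by
  intro F hF
  rw [mem_familyComp_schreierOne]
  rcases F.eq_empty_or_nonempty with rfl | hne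
  · exact ⟨0, fun _ => ∅, fun i => i.elim0, fun i => i.elim0, fun i => i.elim0,
      fun i => i.elim0, by simp⟩
  · refine ⟨1, fun _ => F, fun _ => hne, fun _ => hF, fun i j hij => ?_, fun i a _ => by omega, ?_⟩
    · exact absurd hij (by simp [Subsingleton.elim i j])
    · ext a; simp

/-- The Schreier families are closed under spreading. -/
theorem image_mem_schreierFamily {φ : Ordinal.{0} → ℕ → Ordinal.{0}} (hφ : IsLadderSystem φ)
    {σ : ℕ → ℕ} (hσ : StrictMono σ) {ξ : Ordinal.{0}} (hξ : ξ < ω₁) {F : Finset ℕ}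
    (hF : F ∈ schreierFamily φ ξ) : F.image σ ∈ schreierFamily φ ξ := by
  induction ξ using Ordinal.limitRecOn generalizing F with
  | zero =>
    rw [schreierFamily_zero] at hF ⊢
    rcases hF with rfl | ⟨n, rfl⟩
    · left; simp
    · right; exact ⟨σ n, by simp⟩
  | add_one ξ ih =>
    have hξ₁ : ξ < ω₁ := (lt_add_one ξ).trans hξ
    rw [schreierFamily_add_one, mem_familyComp_schreierOne] at hF ⊢
    obtain ⟨n, G, hG, hB, hlt, hn, rfl⟩ := hF
    refine ⟨n, fun i => (G i).image σ, fun i => (hG i).image σ, fun i => ih hξ₁ (hB i), ?_, ?_, ?_⟩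
    · intro i j hij a ha b hb
      obtain ⟨a', ha', rfl⟩ := Finset.mem_image.1 ha
      obtain ⟨b', hb', rfl⟩ := Finset.mem_image.1 hb
      exact hσ (hlt i j hij a' ha' b' hb')
    · intro i a ha
      obtain ⟨a', ha', rfl⟩ := Finset.mem_image.1 ha
      have := hn i a' ha'
      have := hσ.le_apply (x := a')
      omega
    · exact Finset.biUnion_image ..
  | limit ξ hlim ih =>
    rw [schreierFamily_limit hφ hlim hξ] at hF ⊢
    obtain ⟨n, hn, hF⟩ := hF
    have hlt := (hφ ξ hlim hξ).2.1 n
    refine ⟨n, fun a ha => ?_, ih _ hlt (hlt.trans hξ) hF⟩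
    obtain ⟨b, hb, rfl⟩ := Finset.mem_image.1 ha
    exact (hn b hb).trans hσ.le_apply

/-- The Schreier families increase up to finitely many coordinates: a member of `𝒮_α` that starts
late enough belongs to `𝒮_β` whenever `α ≤ β`. -/
theorem exists_forall_mem_schreierFamily_of_le {φ : Ordinal.{0} → ℕ → Ordinal.{0}}
    (hφ : IsLadderSystem φ) {α β : Ordinal.{0}} (hαβ : α ≤ β) (hβ : β < ω₁) :
    ∃ N : ℕ, ∀ F ∈ schreierFamily φ α, (∀ i ∈ F, N ≤ i) → F ∈ schreierFamily φ β := by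
  induction β using Ordinal.limitRecOn with
  | zero =>
    obtain rfl : α = 0 := le_antisymm hαβ zero_le
    exact ⟨0, fun F hF _ => hF⟩
  | add_one β ih =>
    rcases hαβ.eq_or_lt with rfl | hlt
    · exact ⟨0, fun F hF _ => hF⟩
    · have hβ₁ : β < ω₁ := (lt_add_one β).trans hβ
      obtain ⟨N, hN⟩ := ih (Order.lt_add_one_iff.1 hlt) hβ₁
      refine ⟨N, fun F hF hNF => ?_⟩
      rw [schreierFamily_add_one]
      exact subset_familyComp_schreierOne _ (hN F hF hNF)
  | limit β hlim ih =>
    rcases hαβ.eq_or_lt with rfl | hlt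
    · exact ⟨0, fun F hF _ => hF⟩
    · obtain ⟨-, hlt_n, hlub⟩ := hφ β hlim hβ
      obtain ⟨_, ⟨n, rfl⟩, hn⟩ := (lt_isLUB_iff hlub).1 hlt
      obtain ⟨N, hN⟩ := ih _ (hlt_n n) hn.le ((hlt_n n).trans hβ)
      refine ⟨max N n, fun F hF hNF => ?_⟩
      rw [schreierFamily_limit hφ hlim hβ]
      exact ⟨n, fun i hi => (le_max_right _ _).trans (hNF i hi),
        hN F hF fun i hi => (le_max_left _ _).trans (hNF i hi)⟩

/-- A sequence of nonempty finite sets `G₀ < G₁ < ⋯`. -/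
structure IsSuccessive (G : ℕ → Finset ℕ) : Prop where
  nonempty : ∀ k, (G k).Nonempty
  lt : ∀ k l, k < l → ∀ a ∈ G k, ∀ b ∈ G l, a < b

/-- Substituting members of `B` into members of `A` produces members of `C`, provided that the
substituted sets `G₀ < G₁ < ⋯` start late enough, as prescribed by some function `g`. -/
def SubstitutesInto (B A C : Set (Finset ℕ)) : Prop :=
  ∃ g : ℕ → ℕ, ∀ G : ℕ → Finset ℕ, IsSuccessive G → (∀ k, G k ∈ B) →
    ∀ F ∈ A, (∀ k ∈ F, ∀ a ∈ G k, g k ≤ a) → F.biUnion G ∈ C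

theorem SubstitutesInto.familyComp {A B C : Set (Finset ℕ)} (h : SubstitutesInto B A C) :
    SubstitutesInto B (familyComp schreierOne A) (familyComp schreierOne C) := by
  obtain ⟨g, hg⟩ := h
  refine ⟨fun k => max (g k) k, fun G hG hB F hF hgG => ?_⟩
  rw [mem_familyComp_schreierOne] at hF ⊢
  obtain ⟨n, H, hH, hA, hlt, hn, rfl⟩ := hF
  have hgH : ∀ i, ∀ k ∈ H i, ∀ a ∈ G k, g k ≤ a ∧ k ≤ a := fun i k hk a ha =>
    max_le_iff.1 (hgG k (Finset.mem_biUnion.2 ⟨i, Finset.mem_univ i, hk⟩) a ha)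
  refine ⟨n, fun i => (H i).biUnion G, fun i => ?_, fun i => ?_, ?_, ?_, ?_⟩
  · obtain ⟨k, hk⟩ := hH i
    obtain ⟨a, ha⟩ := hG.nonempty k
    exact ⟨a, Finset.mem_biUnion.2 ⟨k, hk, ha⟩⟩
  · exact hg G hG hB _ (hA i) fun k hk a ha => (hgH i k hk a ha).1
  · intro i j hij a ha b hb
    obtain ⟨k, hk, ha⟩ := Finset.mem_biUnion.1 ha
    obtain ⟨l, hl, hb⟩ := Finset.mem_biUnion.1 hb
    exact hG.lt k l (hlt i j hij k hk l hl) a ha b hb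
  · intro i a ha
    obtain ⟨k, hk, ha⟩ := Finset.mem_biUnion.1 ha
    have := hn i k hk
    have := (hgH i k hk a ha).2
    omega
  · rw [Finset.biUnion_biUnion]

theorem SubstitutesInto.limit {φ : Ordinal.{0} → ℕ → Ordinal.{0}} (hφ : IsLadderSystem φ)
    {B : Set (Finset ℕ)} {ζ η : Ordinal.{0}} (hlim : Order.IsSuccLimit ζ) (hζ : ζ < ω₁)
    (hη : η < ω₁)
    (h : ∀ n, ∃ α ≤ η, SubstitutesInto B (schreierFamily φ (φ ζ n)) (schreierFamily φ α)) :
    SubstitutesInto B (schreierFamily φ ζ) (schreierFamily φ η) := by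
  choose α hα g hg using h
  choose N hN using fun n => exists_forall_mem_schreierFamily_of_le hφ (hα n) hη
  -- A member of `𝒮_ζ` lies in some `𝒮_{ζ_n}` with `n ≤ F`, so the set substituted at `k`
  -- has to obey only the finitely many constraints with `n ≤ k`.
  refine ⟨fun k => (Finset.range (k + 1)).sup fun n => max (g n k) (N n),
    fun G hG hB F hF hgG => ?_⟩
  rw [schreierFamily_limit hφ hlim hζ] at hF
  obtain ⟨n, hn, hF⟩ := hF
  have key : ∀ k ∈ F, ∀ a ∈ G k, g n k ≤ a ∧ N n ≤ a := fun k hk a ha =>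
    max_le_iff.1 ((Finset.le_sup (f := fun n => max (g n k) (N n))
      (Finset.mem_range.2 (Nat.lt_succ_of_le (hn k hk)))).trans (hgG k hk a ha))
  refine hN n _ (hg n G hG hB F hF fun k hk a ha => (key k hk a ha).1) fun a ha => ?_
  obtain ⟨k, hk, ha⟩ := Finset.mem_biUnion.1 ha
  exact (key k hk a ha).2

theorem add_lt_omega_one {ξ ζ : Ordinal.{0}} (hξ : ξ < ω₁) (hζ : ζ < ω₁) : ξ + ζ < ω₁ :=
  Ordinal.isPrincipal_add_omega 1 hξ hζ

/-- `𝒮_ζ[𝒮_ξ]` is contained in `𝒮_{ξ+ζ}`, up to starting the substituted sets late enough. -/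
theorem substitutesInto_schreierFamily_add {φ : Ordinal.{0} → ℕ → Ordinal.{0}}
    (hφ : IsLadderSystem φ) {ξ ζ : Ordinal.{0}} (hξ : ξ < ω₁) (hζ : ζ < ω₁) :
    SubstitutesInto (schreierFamily φ ξ) (schreierFamily φ ζ) (schreierFamily φ (ξ + ζ)) := by
  induction ζ using Ordinal.limitRecOn with
  | zero =>
    obtain ⟨N, hN⟩ := exists_forall_mem_schreierFamily_of_le hφ (zero_le (a := ξ)) hξ
    refine ⟨fun _ => 0, fun G _ hB F hF _ => ?_⟩
    rw [schreierFamily_zero] at hF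
    rw [add_zero]
    rcases hF with rfl | ⟨n, rfl⟩
    · exact hN _ (by simp [schreierFamily_zero]) (by simp)
    · simpa using hB n
  | add_one ζ ih =>
    rw [← add_assoc, schreierFamily_add_one, schreierFamily_add_one]
    exact (ih ((lt_add_one ζ).trans hζ)).familyComp
  | limit ζ hlim ih =>
    refine SubstitutesInto.limit hφ hlim hζ (add_lt_omega_one hξ hζ) fun n => ?_
    have hlt := (hφ ζ hlim hζ).2.1 n
    exact ⟨ξ + φ ζ n, by gcongr, ih _ hlt (hlt.trans hζ)⟩

/-- Doubling the elements of a set of `𝒮_ζ`, `ζ ≥ 1`, does not leave `𝒮_ζ` if the pairs start late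
enough. -/
theorem substitutesInto_schreierFamily_pairs {φ : Ordinal.{0} → ℕ → Ordinal.{0}}
    (hφ : IsLadderSystem φ) {ζ : Ordinal.{0}} (hζ₁ : 1 ≤ ζ) (hζ : ζ < ω₁) :
    SubstitutesInto {P | P.card ≤ 2} (schreierFamily φ ζ) (schreierFamily φ ζ) := by
  have h01 : SubstitutesInto {P | P.card ≤ 2} (schreierFamily φ 0) (schreierFamily φ 1) := by
    rw [schreierFamily_zero, schreierFamily_one]
    refine ⟨fun _ => 1, fun G _ hB F hF hgG a ha => ?_⟩
    rcases hF with rfl | ⟨n, rfl⟩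
    · simp at ha
    · rw [Finset.singleton_biUnion] at ha ⊢
      have h1 := hgG n (Finset.mem_singleton_self n) a ha
      have h2 : (G n).card ≤ 2 := hB n
      simp only at h1
      omega
  induction ζ using Ordinal.limitRecOn with
  | zero => simp at hζ₁
  | add_one ζ ih =>
    rcases eq_or_ne ζ 0 with rfl | h0
    · rw [zero_add, schreierFamily_one]
      refine ⟨fun k => 2 * k + 1, fun G _ hB F hF hgG a ha => ?_⟩
      have hcard : (F.biUnion G).card ≤ F.card * 2 := Finset.card_biUnion_le_card_mul _ _ _
        fun k _ => hB k
      obtain ⟨k, hk, ha⟩ := Finset.mem_biUnion.1 ha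
      have h1 := hF k hk
      have h2 := hgG k hk a ha
      simp only at h2
      omega
    · rw [schreierFamily_add_one]
      exact (ih (Order.one_le_iff_ne_zero.2 h0) ((lt_add_one ζ).trans hζ)).familyComp
  | limit ζ hlim ih =>
    refine SubstitutesInto.limit hφ hlim hζ hζ fun n => ?_
    have hlt := (hφ ζ hlim hζ).2.1 n
    rcases eq_or_ne (φ ζ n) 0 with h0 | h0
    · exact ⟨1, hζ₁, by rwa [h0]⟩
    · exact ⟨φ ζ n, hlt.le, ih _ hlt (Order.one_le_iff_ne_zero.2 h0) (hlt.trans hζ)⟩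

/-! ### Grunblum's criterion for basic sequences -/

/-- Grunblum's condition with constant `K`: the initial projections on the linear span of `x` are
bounded by `K`. It is stated for vectors of complementary spans instead of coefficients, so that it
passes to block sequences at once. -/
def GrunblumWith (𝕜 : Type*) [RCLike 𝕜] {X : Type*} [NormedAddCommGroup X] [NormedSpace 𝕜 X]
    (K : ℝ) (x : ℕ → X) : Prop :=
  ∀ m : ℕ, ∀ u ∈ Submodule.span 𝕜 (x '' Set.Iio m), ∀ v ∈ Submodule.span 𝕜 (x '' Set.Ici m),
    ‖u‖ ≤ K * ‖u + v‖

section basic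

variable {𝕜 : Type*} [RCLike 𝕜] {X : Type*} [NormedAddCommGroup X] [NormedSpace 𝕜 X]

theorem IsBasicSequence.linearIndependent {x : ℕ → X} (hx : IsBasicSequence 𝕜 x) :
    LinearIndependent 𝕜 x := by
  obtain ⟨b, hb⟩ := hx
  have h := b.linearIndependent.map' (Submodule.subtype _) (Submodule.ker_subtype _)
  have he : (Submodule.subtype _ ∘ b : ℕ → X) = x := funext hb
  rwa [he] at h

theorem IsBasicSequence.exists_grunblumWith [CompleteSpace X] {x : ℕ → X}
    (hx : IsBasicSequence 𝕜 x) : ∃ K, 0 < K ∧ GrunblumWith 𝕜 K x := by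
  obtain ⟨b, hb⟩ := hx
  obtain ⟨C, hC⟩ := SchauderBasis.exists_norm_proj_le b
  refine ⟨max C 1, by positivity, fun m u hu v hv => ?_⟩
  have himage : ∀ s : Set ℕ, Submodule.span 𝕜 (x '' s) =
      (Submodule.span 𝕜 (b '' s)).map (Submodule.subtype _) := by
    intro s
    rw [Submodule.map_span, ← Set.image_comp]
    congr 2
    exact (funext hb).symm
  rw [himage] at hu hv
  obtain ⟨u, hu, rfl⟩ := hu
  obtain ⟨v, hv, rfl⟩ := hv
  have hPu : SchauderBasis.proj b m u = u := by
    have hle : Submodule.span 𝕜 (b '' Set.Iio m) ≤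
        LinearMap.eqLocus (SchauderBasis.proj b m).toLinearMap LinearMap.id := by
      rw [Submodule.span_le]
      rintro _ ⟨i, hi, rfl⟩
      have := SchauderBasis.proj_apply_basis_mem b m i
      rw [if_pos (Set.mem_Iio.1 hi)] at this
      exact this
    exact hle hu
  have hPv : SchauderBasis.proj b m v = 0 := by
    have hle : Submodule.span 𝕜 (b '' Set.Ici m) ≤
        LinearMap.ker (SchauderBasis.proj b m).toLinearMap := by
      rw [Submodule.span_le]
      rintro _ ⟨i, hi, rfl⟩
      have := SchauderBasis.proj_apply_basis_mem b m i
      rw [if_neg (not_lt.2 hi)] at this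
      exact this
    exact hle hv
  have h := (SchauderBasis.proj b m).le_of_opNorm_le (hC m) (u + v)
  rw [map_add, hPu, hPv, add_zero] at h
  exact h.trans (mul_le_mul_of_nonneg_right (le_max_left _ _) (norm_nonneg _))

theorem GrunblumWith.norm_tail_le {K : ℝ} {x : ℕ → X} (hx : GrunblumWith 𝕜 K x) {m : ℕ} {u v : X}
    (hu : u ∈ Submodule.span 𝕜 (x '' Set.Iio m)) (hv : v ∈ Submodule.span 𝕜 (x '' Set.Ici m)) :
    ‖v‖ ≤ (K + 1) * ‖u + v‖ := by
  have h1 := hx m u hu v hv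
  have h2 : ‖v‖ ≤ ‖u + v‖ + ‖u‖ := by simpa using norm_sub_le (u + v) u
  linarith

/-- The terms `a • x n` of the expansion of a vector are bounded by a multiple of that vector. -/
theorem GrunblumWith.norm_smul_le {K : ℝ} {x : ℕ → X} (hK : 0 ≤ K) (hx : GrunblumWith 𝕜 K x)
    {n : ℕ} {v : X} (a : 𝕜) (hv : v ∈ Submodule.span 𝕜 (x '' {n}ᶜ)) :
    ‖a • x n‖ ≤ K * (K + 1) * ‖a • x n + v‖ := by
  have hset : ({n}ᶜ : Set ℕ) = Set.Iio n ∪ Set.Ici (n + 1) := by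
    ext i
    simp only [Set.mem_compl_iff, Set.mem_singleton_iff, Set.mem_union, Set.mem_Iio, Set.mem_Ici]
    omega
  rw [hset, Set.image_union, Submodule.span_union] at hv
  obtain ⟨u, hu, w, hw, rfl⟩ := Submodule.mem_sup.1 hv
  have hxn : ∀ s : Set ℕ, n ∈ s → a • x n ∈ Submodule.span 𝕜 (x '' s) := fun s hs =>
    Submodule.smul_mem _ _ (Submodule.subset_span (Set.mem_image_of_mem x hs))
  have h1 := hx (n + 1) (a • x n) (hxn _ (by simp)) w hw
  have hw' : w ∈ Submodule.span 𝕜 (x '' Set.Ici n) :=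
    Submodule.span_mono (Set.image_mono (Set.Ici_subset_Ici.2 (Nat.le_succ n))) hw
  have h2 := hx.norm_tail_le hu (Submodule.add_mem _ (hxn (Set.Ici n) (by simp)) hw')
  have h3 : u + (a • x n + w) = a • x n + (u + w) := by abel
  rw [h3] at h2
  calc ‖a • x n‖ ≤ K * ‖a • x n + w‖ := h1
    _ ≤ K * ((K + 1) * ‖a • x n + (u + w)‖) := mul_le_mul_of_nonneg_left h2 hK
    _ = _ := by ring

/-- Coordinate functionals of a Grunblum sequence, defined on the whole space. -/
theorem GrunblumWith.exists_biorthogonal {K : ℝ} {x : ℕ → X} (hK : 0 ≤ K)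
    (hx : GrunblumWith 𝕜 K x) (h0 : ∀ n, x n ≠ 0) (n : ℕ) :
    ∃ g : StrongDual 𝕜 X, ∀ i, g (x i) = if i = n then 1 else 0 := by
  set W := (Submodule.span 𝕜 (x '' {n}ᶜ)).topologicalClosure with hW
  have hWc : IsClosed (W : Set X) := Submodule.isClosed_topologicalClosure _
  have hn : x n ∉ W := by
    intro hmem
    have hcl : IsClosed {w : X | ‖x n‖ ≤ K * (K + 1) * ‖x n - w‖} :=
      isClosed_le continuous_const (by fun_prop)
    have hsub : (W : Set X) ⊆ {w : X | ‖x n‖ ≤ K * (K + 1) * ‖x n - w‖} := by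
      rw [hW, Submodule.topologicalClosure_coe]
      refine closure_minimal (fun w hw => ?_) hcl
      have := hx.norm_smul_le hK (1 : 𝕜) (Submodule.neg_mem _ hw)
      simpa [sub_eq_add_neg] using this
    have := hsub hmem
    simp [h0 n] at this
  have hq : (Submodule.Quotient.mk (p := W) (x n)) ≠ 0 := by
    rwa [Ne, Submodule.Quotient.mk_eq_zero]
  obtain ⟨f, hf⟩ := SeparatingDual.exists_eq_one (R := 𝕜) hq
  refine ⟨f.comp W.mkQL, fun i => ?_⟩
  split_ifs with h
  · subst h; exact hf
  · have : x i ∈ W := Submodule.le_topologicalClosure _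
      (Submodule.subset_span (Set.mem_image_of_mem x h))
    have h2 : W.mkQL (x i) = 0 := (Submodule.Quotient.mk_eq_zero W).2 this
    simp [h2]

/-- **Grunblum's criterion.** -/
theorem GrunblumWith.isBasicSequence {K : ℝ} {x : ℕ → X} (hK : 0 ≤ K)
    (hx : GrunblumWith 𝕜 K x) (h0 : ∀ n, x n ≠ 0) : IsBasicSequence 𝕜 x := by
  choose g hg using hx.exists_biorthogonal hK h0
  set E := Submodule.span 𝕜 (Set.range x) with hE
  let P : ℕ → X →L[𝕜] X := fun m => ∑ i ∈ Finset.range m, (g i).smulRight (x i)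
  have hP : ∀ m w, P m w = ∑ i ∈ Finset.range m, g i w • x i := by
    intro m w
    simp [P]
  have hPx : ∀ m j, P m (x j) = if j < m then x j else 0 := by
    intro m j
    rw [hP]
    simp [hg]
  have hPmem : ∀ m w, P m w ∈ Submodule.span 𝕜 (x '' Set.Iio m) := by
    intro m w
    rw [hP]
    exact Submodule.sum_mem _ fun i hi => Submodule.smul_mem _ _
      (Submodule.subset_span (Set.mem_image_of_mem x (by simpa using hi)))
  have hPtail : ∀ m, ∀ w ∈ E, w - P m w ∈ Submodule.span 𝕜 (x '' Set.Ici m) := by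
    intro m
    have hle : E ≤ (Submodule.span 𝕜 (x '' Set.Ici m)).comap
        ((ContinuousLinearMap.id 𝕜 X - P m : X →L[𝕜] X) : X →ₗ[𝕜] X) := by
      rw [hE, Submodule.span_le]
      rintro _ ⟨j, rfl⟩
      simp only [Submodule.comap_coe, Set.mem_preimage, ContinuousLinearMap.coe_coe,
        sub_apply, ContinuousLinearMap.id_apply, SetLike.mem_coe, hPx]
      split_ifs with h
      · simp
      · rw [sub_zero]
        exact Submodule.subset_span (Set.mem_image_of_mem x (not_lt.1 h))
    intro w hw
    exact hle hw
  have hbound : ∀ m, ∀ w ∈ E.topologicalClosure, ‖P m w‖ ≤ K * ‖w‖ := by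
    intro m
    have hcl : IsClosed {w : X | ‖P m w‖ ≤ K * ‖w‖} :=
      isClosed_le (by fun_prop) (by fun_prop)
    have hsub : (E : Set X) ⊆ {w : X | ‖P m w‖ ≤ K * ‖w‖} := fun w hw => by
      simpa using hx m _ (hPmem m w) _ (hPtail m w hw)
    exact closure_minimal hsub hcl
  have hev : ∀ w ∈ E, ∀ᶠ m in atTop, P m w = w := by
    intro w hw
    induction hw using Submodule.span_induction with
    | mem w hw =>
      obtain ⟨j, rfl⟩ := hw
      filter_upwards [eventually_gt_atTop j] with m hm
      rw [hPx, if_pos hm]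
    | zero => simp
    | add v w _ _ hv hw => filter_upwards [hv, hw] with m h1 h2; rw [map_add, h1, h2]
    | smul a w _ hw => filter_upwards [hw] with m h; rw [map_smul, h]
  have htends : ∀ w ∈ E.topologicalClosure, Tendsto (fun m => P m w) atTop (𝓝 w) := by
    intro w hw
    rw [Metric.tendsto_atTop]
    intro ε hε
    have hw' : w ∈ closure (E : Set X) := hw
    obtain ⟨e, he, hwe⟩ := Metric.mem_closure_iff.1 hw' (ε / (K + 1)) (by positivity)
    obtain ⟨N, hN⟩ := eventually_atTop.1 (hev e he)
    refine ⟨N, fun m hm => ?_⟩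
    have h1 := hbound m (w - e) (Submodule.sub_mem _ hw (Submodule.le_topologicalClosure _ he))
    have h2 : P m w - w = P m (w - e) - (w - e) := by rw [map_sub, hN m hm]; abel
    rw [dist_eq_norm, h2]
    rw [dist_eq_norm, lt_div_iff₀ (by positivity)] at hwe
    calc ‖P m (w - e) - (w - e)‖ ≤ ‖P m (w - e)‖ + ‖w - e‖ := norm_sub_le _ _
      _ ≤ ‖w - e‖ * (K + 1) := by linarith
      _ < ε := hwe
  refine ⟨{ basis := fun n => ⟨x n, Submodule.le_topologicalClosure _
              (Submodule.subset_span (Set.mem_range_self n))⟩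
            coord := fun n => (g n).comp E.topologicalClosure.subtypeL
            ortho := fun i j => ?_
            expansion := fun w => ?_ }, fun n => rfl⟩
  · simp [hg, Pi.single_apply, eq_comm]
  · rw [HasSum, SummationFilter.conditional_filter_eq_map_range, tendsto_map'_iff,
      tendsto_subtype_rng]
    refine (htends w w.2).congr fun m => ?_
    simp [hP]

theorem IsBasicSequence.ne_zero {x : ℕ → X} (hx : IsBasicSequence 𝕜 x) (n : ℕ) : x n ≠ 0 :=
  hx.linearIndependent.ne_zero n

/-- Block sequences of Grunblum sequences are Grunblum sequences, with the same constant. -/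
theorem GrunblumWith.block {K : ℝ} {x z : ℕ → X} (hx : GrunblumWith 𝕜 K x) {G : ℕ → Finset ℕ}
    (hG : IsSuccessive G) (hz : ∀ k, z k ∈ Submodule.span 𝕜 (x '' (G k : Set ℕ))) :
    GrunblumWith 𝕜 K z := by
  intro m u hu v hv
  refine hx ((G m).min' (hG.nonempty m)) u ?_ v ?_
  · refine (Submodule.span_le.2 ?_) hu
    rintro _ ⟨k, hk, rfl⟩
    refine Submodule.span_mono (Set.image_mono fun a ha => ?_) (hz k)
    exact hG.lt k m hk a ha _ (Finset.min'_mem _ _)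
  · refine (Submodule.span_le.2 ?_) hv
    rintro _ ⟨k, hk, rfl⟩
    refine Submodule.span_mono (Set.image_mono fun a ha => ?_) (hz k)
    rcases eq_or_lt_of_le (show m ≤ k from hk) with rfl | h
    · exact Finset.min'_le _ _ ha
    · exact (hG.lt m k h _ (Finset.min'_mem _ _) a ha).le

theorem IsBasicSequence.comp_strictMono [CompleteSpace X] {x : ℕ → X} (hx : IsBasicSequence 𝕜 x)
    {σ : ℕ → ℕ} (hσ : StrictMono σ) : IsBasicSequence 𝕜 (x ∘ σ) := by
  obtain ⟨K, hK, hxK⟩ := hx.exists_grunblumWith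
  refine (hxK.block (G := fun k => {σ k}) ⟨fun k => by simp, fun k l hkl a ha b hb => ?_⟩
    fun k => ?_).isBasicSequence hK.le fun n => hx.ne_zero _
  · rw [Finset.mem_singleton.1 ha, Finset.mem_singleton.1 hb]
    exact hσ hkl
  · exact Submodule.subset_span (by simp)

end basic

/-! ### Selecting basic sequences -/

/-- Dependent choice, where each term may depend on the list of all the previous ones. -/
theorem exists_seq_forall_list {α : Type*} {R : List α → α → Prop} (h : ∀ l, ∃ a, R l a) :
    ∃ f : ℕ → α, ∀ n, R ((List.range n).map f) (f n) := by
  choose c hc using h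
  let L : ℕ → List α := fun n => Nat.rec [] (fun _ l => l ++ [c l]) n
  have hL : ∀ n, L n = (List.range n).map fun k => c (L k) := by
    intro n
    induction n with
    | zero => rfl
    | succ n ih =>
      rw [List.range_succ, List.map_append, ← ih]
      rfl
  refine ⟨fun n => c (L n), fun n => ?_⟩
  rw [← hL]
  exact hc _

theorem List.exists_forall_lt_nat {α : Type*} (l : List α) (f : α → ℕ) :
    ∃ N, ∀ a ∈ l, f a < N := by
  refine ⟨(l.map f).sum + 1, fun a ha => Nat.lt_succ_of_le ?_⟩
  exact List.single_le_sum (fun _ _ => Nat.zero_le _) _ (List.mem_map_of_mem ha)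

section basic

variable {𝕜 : Type*} [RCLike 𝕜] {X : Type*} [NormedAddCommGroup X] [NormedSpace 𝕜 X]

/-- Finitely many functionals of norm at most one almost norm a finite-dimensional subspace. -/
theorem exists_finset_almost_norming (E : Submodule 𝕜 X) [FiniteDimensional 𝕜 E] {η : ℝ}
    (hη : 0 < η) :
    ∃ J : Finset (StrongDual 𝕜 X), (∀ f ∈ J, ‖f‖ ≤ 1) ∧
      ∀ e ∈ E, e ≠ 0 → ∃ f ∈ J, (1 - η) * ‖e‖ ≤ ‖f e‖ := by
  classical
  have : ProperSpace E := FiniteDimensional.proper_rclike 𝕜 E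
  choose f hf using fun e : E => exists_dual_vector'' 𝕜 (e : X)
  obtain ⟨t, -, ht⟩ := (isCompact_sphere (0 : E) 1).elim_nhds_subcover
    (fun e => {w : E | 1 - η < ‖f e w‖}) (fun e he => by
      refine (isOpen_lt continuous_const (by fun_prop)).mem_nhds ?_
      have h1 : ‖(e : X)‖ = 1 := by simpa using he
      simp [hf, h1, hη])
  refine ⟨t.image f, fun g hg => ?_, fun e he h0 => ?_⟩
  · obtain ⟨e, -, rfl⟩ := Finset.mem_image.1 hg
    exact (hf e).1
  · have hpos : 0 < ‖e‖ := norm_pos_iff.2 h0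
    have hmem : (((‖e‖⁻¹ : ℝ) : 𝕜) • (⟨e, he⟩ : E)) ∈ Metric.sphere (0 : E) 1 := by
      rw [mem_sphere_zero_iff_norm, norm_smul, RCLike.norm_ofReal, abs_of_pos (by positivity)]
      exact inv_mul_cancel₀ hpos.ne'
    obtain ⟨d, hd, hlt⟩ := Set.mem_iUnion₂.1 (ht hmem)
    refine ⟨f d, Finset.mem_image_of_mem f hd, ?_⟩
    simp only [Set.mem_ofPred_eq, Submodule.coe_smul, map_smul, norm_smul, RCLike.norm_ofReal,
      abs_of_pos (inv_pos.2 hpos)] at hlt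
    rw [inv_mul_eq_div, lt_div_iff₀ hpos] at hlt
    exact hlt.le

/-- Mazur's lemma: vectors of norm at least `r` that are nearly annihilated by suitable finitely many
functionals are nearly orthogonal to a given finite-dimensional subspace. -/
theorem exists_finset_forall_norm_le_mul_norm_add (E : Submodule 𝕜 X) [FiniteDimensional 𝕜 E]
    {c : ℝ} (hc : 1 < c) :
    ∃ J : Finset (StrongDual 𝕜 X), ∀ r > 0, ∃ δ > 0, ∀ d : X, r ≤ ‖d‖ → (∀ f ∈ J, ‖f d‖ ≤ δ) →
      ∀ e ∈ E, ∀ t : 𝕜, ‖e‖ ≤ c * ‖e + t • d‖ := by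
  have hc0 : 0 < c := by linarith
  set η : ℝ := (1 - 1 / c) / 2 with hη
  have hη0 : 0 < η := by
    have : 1 / c < 1 := by rw [div_lt_one hc0]; exact hc
    linarith
  have hcη : c * (1 - 2 * η) = 1 := by rw [hη]; field_simp; ring
  obtain ⟨J, hJ, hJn⟩ := exists_finset_almost_norming E hη0
  refine ⟨J, fun r hr => ⟨η * r / 3, by positivity, fun d hd hJd e he t => ?_⟩⟩
  rcases eq_or_ne e 0 with rfl | h0
  · simpa using by positivity
  have he0 : 0 < ‖e‖ := norm_pos_iff.2 h0
  -- For a large multiple of `d` the triangle inequality suffices; otherwise the functional that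
  -- almost norms `e` is hardly affected by `t • d`.
  rcases le_or_gt (2 * ‖e‖) (‖t‖ * r) with ht | ht
  · have h1 : ‖t • d‖ ≤ ‖e + t • d‖ + ‖e‖ := by simpa using norm_sub_le (e + t • d) e
    rw [norm_smul] at h1
    have h2 : ‖t‖ * r ≤ ‖t‖ * ‖d‖ := by gcongr
    have h3 : ‖e‖ ≤ ‖e + t • d‖ := by linarith
    exact h3.trans (le_mul_of_one_le_left (norm_nonneg _) hc.le)
  · obtain ⟨f, hf, hfe⟩ := hJn e he h0
    have h1 : ‖f e‖ ≤ ‖f (e + t • d)‖ + ‖t‖ * ‖f d‖ := by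
      have := norm_sub_le (f (e + t • d)) (t • f d)
      rwa [norm_smul, ← map_smul, ← map_sub, add_sub_cancel_right] at this
    have h2 : ‖f (e + t • d)‖ ≤ ‖e + t • d‖ := by
      simpa using f.le_of_opNorm_le (hJ f hf) (e + t • d)
    have h3 : ‖t‖ * ‖f d‖ ≤ η * ‖e‖ := by
      calc ‖t‖ * ‖f d‖ ≤ ‖t‖ * (η * r / 3) := by gcongr; exact hJd f hf
        _ = η / 3 * (‖t‖ * r) := by ring
        _ ≤ η / 3 * (2 * ‖e‖) := by gcongr
        _ ≤ η * ‖e‖ := by nlinarith [mul_pos hη0 he0]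
    have h4 : (1 - 2 * η) * ‖e‖ ≤ ‖e + t • d‖ := by linarith
    calc ‖e‖ = c * ((1 - 2 * η) * ‖e‖) := by rw [← mul_assoc, hcη, one_mul]
      _ ≤ c * ‖e + t • d‖ := by gcongr

/-- Mazur's construction: a sequence whose terms are nearly orthogonal to the span of their
predecessors is a Grunblum sequence. The constants are `κ (n + 1) / κ n` for `κ n = 2 - 2⁻ⁿ`, so
that all their products stay below `2`. -/
theorem grunblumWith_two_of_forall_norm_le {d : ℕ → X}
    (h : ∀ n, ∀ e ∈ Submodule.span 𝕜 (d '' Set.Iio n), ∀ t : 𝕜,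
      ‖e‖ ≤ (2 - (1 / 2 : ℝ) ^ (n + 1)) / (2 - (1 / 2 : ℝ) ^ n) * ‖e + t • d n‖) :
    GrunblumWith 𝕜 2 d := by
  set κ : ℕ → ℝ := fun n => 2 - (1 / 2 : ℝ) ^ n with hκ
  have hκ1 : ∀ n, 1 ≤ κ n := fun n => by
    have : (1 / 2 : ℝ) ^ n ≤ 1 := pow_le_one₀ (by norm_num) (by norm_num)
    simp only [hκ]; linarith
  have hκ2 : ∀ n, κ n ≤ 2 := fun n => by
    have : 0 < (1 / 2 : ℝ) ^ n := by positivity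
    simp only [hκ]; linarith
  intro m u hu v hv
  have key : ∀ n, ∀ v ∈ Submodule.span 𝕜 (d '' Set.Ico m (m + n)),
      κ m * ‖u‖ ≤ κ (m + n) * ‖u + v‖ := by
    intro n
    induction n with
    | zero =>
      intro v hv
      have hv0 : v = 0 := by simpa using hv
      simp [hv0]
    | succ n ih =>
      intro v hv
      have hset : Set.Ico m (m + (n + 1)) = insert (m + n) (Set.Ico m (m + n)) := by
        ext i; simp only [Set.mem_Ico, Set.mem_insert_iff]; omega
      rw [hset, Set.image_insert_eq, Submodule.mem_span_insert] at hv
      obtain ⟨t, w, hw, rfl⟩ := hv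
      have hmem : u + w ∈ Submodule.span 𝕜 (d '' Set.Iio (m + n)) := by
        refine Submodule.add_mem _ (Submodule.span_mono (Set.image_mono ?_) hu)
          (Submodule.span_mono (Set.image_mono ?_) hw)
        · exact Set.Iio_subset_Iio (Nat.le_add_right m n)
        · exact fun i hi => hi.2
      have h1 := h (m + n) _ hmem t
      have hpos : 0 < κ (m + n) := zero_lt_one.trans_le (hκ1 _)
      calc κ m * ‖u‖ ≤ κ (m + n) * ‖u + w‖ := ih w hw
        _ ≤ κ (m + n) * (κ (m + n + 1) / κ (m + n) * ‖u + w + t • d (m + n)‖) :=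
          mul_le_mul_of_nonneg_left h1 hpos.le
        _ = κ (m + (n + 1)) * ‖u + (t • d (m + n) + w)‖ := by
          rw [← mul_assoc, mul_div_cancel₀ _ hpos.ne', add_assoc u, add_comm w, add_assoc m]
  have hv' : ∃ n, v ∈ Submodule.span 𝕜 (d '' Set.Ico m (m + n)) := by
    have hmono : ∀ n n', n ≤ n' → Submodule.span 𝕜 (d '' Set.Ico m (m + n)) ≤
        Submodule.span 𝕜 (d '' Set.Ico m (m + n')) := fun n n' hn =>
      Submodule.span_mono (Set.image_mono (Set.Ico_subset_Ico_right (by omega)))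
    induction hv using Submodule.span_induction with
    | mem w hw =>
      obtain ⟨j, hj, rfl⟩ := hw
      refine ⟨j + 1, Submodule.subset_span (Set.mem_image_of_mem d ⟨hj, by omega⟩)⟩
    | zero => exact ⟨0, Submodule.zero_mem _⟩
    | add v w _ _ hv hw =>
      obtain ⟨n, hn⟩ := hv
      obtain ⟨n', hn'⟩ := hw
      exact ⟨max n n', Submodule.add_mem _ (hmono _ _ (le_max_left _ _) hn)
        (hmono _ _ (le_max_right _ _) hn')⟩
    | smul a w _ hw =>
      obtain ⟨n, hn⟩ := hw
      exact ⟨n, Submodule.smul_mem _ _ hn⟩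
  obtain ⟨n, hn⟩ := hv'
  calc ‖u‖ ≤ κ m * ‖u‖ := le_mul_of_one_le_left (norm_nonneg _) (hκ1 m)
    _ ≤ κ (m + n) * ‖u + v‖ := key n v hn
    _ ≤ 2 * ‖u + v‖ := mul_le_mul_of_nonneg_right (hκ2 _) (norm_nonneg _)

/-- If vectors nearly orthogonal to any finite-dimensional subspace can be found among the `v a`,
where the choice of `a` may be constrained by the previous choices, then there is a basic sequence
consisting of such vectors. -/
theorem exists_isBasicSequence_comp {α : Type*} (v : α → X) {R : List α → α → Prop}
    (h : ∀ (l : List α) (E : Submodule 𝕜 X) [FiniteDimensional 𝕜 E] (c : ℝ), 1 < c →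
      ∃ a, R l a ∧ v a ≠ 0 ∧ ∀ e ∈ E, ∀ t : 𝕜, ‖e‖ ≤ c * ‖e + t • v a‖) :
    ∃ a : ℕ → α, IsBasicSequence 𝕜 (v ∘ a) ∧ ∀ n, R ((List.range n).map a) (a n) := by
  have step : ∀ l : List α, ∃ a, R l a ∧ v a ≠ 0 ∧
      ∀ e ∈ Submodule.span 𝕜 (v '' {b | b ∈ l}), ∀ t : 𝕜, ‖e‖ ≤
        (2 - (1 / 2 : ℝ) ^ (l.length + 1)) / (2 - (1 / 2 : ℝ) ^ l.length) * ‖e + t • v a‖ := by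
    intro l
    have hfin : (v '' {b | b ∈ l}).Finite := (List.finite_toSet l).image v
    have : FiniteDimensional 𝕜 (Submodule.span 𝕜 (v '' {b | b ∈ l})) :=
      FiniteDimensional.span_of_finite 𝕜 hfin
    refine h l _ _ ?_
    have h1 : (1 / 2 : ℝ) ^ l.length ≤ 1 := pow_le_one₀ (by norm_num) (by norm_num)
    have h2 : 0 < (1 / 2 : ℝ) ^ l.length := by positivity
    rw [one_lt_div (by linarith), pow_succ]
    linarith
  obtain ⟨a, ha⟩ := exists_seq_forall_list step
  refine ⟨a, GrunblumWith.isBasicSequence zero_le_two ?_ fun n => (ha n).2.1,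
    fun n => (ha n).1⟩
  refine grunblumWith_two_of_forall_norm_le fun n e he t => ?_
  have h1 := (ha n).2.2 e ?_ t
  · simpa using h1
  · refine Submodule.span_mono ?_ he
    rintro _ ⟨k, hk, rfl⟩
    exact ⟨a k, List.mem_map_of_mem (List.mem_range.2 hk), rfl⟩

/-- Every infinite-dimensional subspace contains a basic sequence. -/
theorem exists_isBasicSequence_of_not_finiteDimensional (Z : Submodule 𝕜 X)
    (hZ : ¬ FiniteDimensional 𝕜 Z) : ∃ x : ℕ → X, IsBasicSequence 𝕜 x ∧ ∀ n, x n ∈ Z := by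
  refine exists_isBasicSequence_comp (fun x : X => x) (R := fun _ x => x ∈ Z)
    fun _ E _ c hc => ?_
  obtain ⟨J, hJ⟩ := exists_finset_forall_norm_le_mul_norm_add E hc
  have hker : ∃ z : Z, z ≠ 0 ∧ ∀ f ∈ J, f z = 0 := by
    by_contra! hcon
    refine hZ (FiniteDimensional.of_injective (LinearMap.pi
      (fun f : J => (f : StrongDual 𝕜 X).toLinearMap ∘ₗ Z.subtype) : Z →ₗ[𝕜] (J → 𝕜)) ?_)
    rw [injective_iff_map_eq_zero]
    intro z hz
    by_contra h0
    obtain ⟨f, hf, hfz⟩ := hcon z h0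
    exact hfz (congrFun hz ⟨f, hf⟩)
  obtain ⟨z, hz0, hz⟩ := hker
  have hz0' : (z : X) ≠ 0 := by simpa using hz0
  obtain ⟨δ, hδ, hd⟩ := hJ ‖(z : X)‖ (norm_pos_iff.2 hz0')
  exact ⟨z, z.2, hz0', hd z le_rfl fun f hf => by simp [hz f hf, hδ.le]⟩

/-- Finitely many functionals are nearly constant on infinitely many terms of a bounded sequence. -/
theorem exists_lt_forall_norm_apply_sub_le {y : ℕ → X} {C : ℝ} (hy : ∀ n, ‖y n‖ ≤ C)
    (J : Finset (StrongDual 𝕜 X)) {δ : ℝ} (hδ : 0 < δ) (N : ℕ) :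
    ∃ p q, N ≤ p ∧ p < q ∧ ∀ f ∈ J, ‖f (y p - y q)‖ ≤ δ := by
  let Φ : X →L[𝕜] (J → 𝕜) := ContinuousLinearMap.pi fun f => (f : StrongDual 𝕜 X)
  have hbd : Bornology.IsBounded (Set.range fun n => Φ (y n)) := by
    rw [isBounded_iff_forall_norm_le]
    refine ⟨‖Φ‖ * C, ?_⟩
    rintro _ ⟨n, rfl⟩
    exact Φ.le_opNorm_of_le (hy n)
  obtain ⟨a, -, σ, hσ, ha⟩ := tendsto_subseq_of_bounded hbd (fun n => Set.mem_range_self n)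
  obtain ⟨M, hM⟩ := Metric.cauchySeq_iff.1 ha.cauchySeq δ hδ
  refine ⟨σ (max M N), σ (max M N + 1), (le_max_right _ _).trans hσ.le_apply,
    hσ (Nat.lt_succ_self _), fun f hf => ?_⟩
  have h1 := hM (max M N) (le_max_left _ _) (max M N + 1) ((le_max_left _ _).trans (Nat.le_succ _))
  rw [dist_eq_norm] at h1
  have h2 := (norm_le_pi_norm (Φ (y (σ (max M N))) - Φ (y (σ (max M N + 1)))) ⟨f, hf⟩).trans h1.le
  rw [map_sub]
  exact h2

end basic

/-! ### `𝒮_ξ`-strictly singular operators -/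

section singular

variable {𝕜 : Type*} [RCLike 𝕜]
variable {X : Type*} [NormedAddCommGroup X] [NormedSpace 𝕜 X]
variable {Y : Type*} [NormedAddCommGroup Y] [NormedSpace 𝕜 Y]
variable {W : Type*} [NormedAddCommGroup W] [NormedSpace 𝕜 W]
variable {φ : Ordinal.{0} → ℕ → Ordinal.{0}} {ξ ζ : Ordinal.{0}}

/-- The witnesses of `𝒮_ξ`-strict singularity can be chosen arbitrarily far along the basic
sequence, as tails of basic sequences are basic and `𝒮_ξ` is closed under spreading. -/
theorem IsSchreierSingular.exists_far [CompleteSpace X] (hφ : IsLadderSystem φ) (hξ : ξ < ω₁)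
    {T : X →L[𝕜] Y} (hT : IsSchreierSingular φ ξ T) {ε : ℝ} (hε : 0 < ε) {x : ℕ → X}
    (hx : IsBasicSequence 𝕜 x) (N : ℕ) :
    ∃ F ∈ schreierFamily φ ξ, (∀ i ∈ F, N ≤ i) ∧ ∃ z ∈ Submodule.span 𝕜 (x '' (F : Set ℕ)),
      z ≠ 0 ∧ ‖T z‖ ≤ ε * ‖z‖ := by
  have hσ : StrictMono fun i => N + i := fun i j hij => Nat.add_lt_add_left hij N
  obtain ⟨F, hF, z, hz, hz0, hTz⟩ := hT ε hε _ (hx.comp_strictMono hσ)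
  refine ⟨F.image fun i => N + i, image_mem_schreierFamily hφ hσ hξ hF, fun i hi => ?_,
    z, ?_, hz0, hTz⟩
  · obtain ⟨j, -, rfl⟩ := Finset.mem_image.1 hi
    exact Nat.le_add_right N j
  · rwa [Finset.coe_image, ← Set.image_comp]

theorem IsSchreierSingular.mono [CompleteSpace X] (hφ : IsLadderSystem φ) (h : ξ ≤ ζ)
    (hζ : ζ < ω₁) {T : X →L[𝕜] Y} (hT : IsSchreierSingular φ ξ T) :
    IsSchreierSingular φ ζ T := by
  intro ε hε x hx
  obtain ⟨N, hN⟩ := exists_forall_mem_schreierFamily_of_le hφ h hζ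
  obtain ⟨F, hF, hNF, z, hz⟩ := hT.exists_far hφ (h.trans_lt hζ) hε hx N
  exact ⟨F, hN F hF hNF, z, hz⟩

/-- A finitely strictly singular operator is `𝒮_ξ`-strictly singular, because `𝒮_ξ` contains sets of
every size. -/
theorem IsFinitelyStrictlySingular.isSchreierSingular (hφ : IsLadderSystem φ) (hξ₁ : 1 ≤ ξ)
    (hξ : ξ < ω₁) {T : X →L[𝕜] Y} (hT : IsFinitelyStrictlySingular T) :
    IsSchreierSingular φ ξ T := by
  intro ε hε x hx
  obtain ⟨N, hN⟩ := exists_forall_mem_schreierFamily_of_le hφ hξ₁ hξ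
  obtain ⟨n, hn⟩ := hT ε hε
  refine ⟨Finset.Ico (N + n) (N + n + n), hN _ ?_ fun i hi => ?_, ?_⟩
  · rw [schreierFamily_one]
    intro i hi
    rw [Finset.mem_Ico] at hi
    rw [Nat.card_Ico]
    omega
  · rw [Finset.mem_Ico] at hi
    omega
  · classical
    have hrank : Module.rank 𝕜
        (Submodule.span 𝕜 (x '' (Finset.Ico (N + n) (N + n + n) : Finset ℕ))) = n := by
      rw [rank_span_set (hx.linearIndependent.linearIndepOn _).id_image,
        ← Finset.coe_image, Finset.coe_sort_coe, Cardinal.mk_coe_finset,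
        Finset.card_image_of_injective _ hx.linearIndependent.injective, Nat.card_Ico]
      simp
    obtain ⟨z, hz, hTz⟩ := hn _ hrank.ge
    refine ⟨z, hz, ?_, hTz.le⟩
    rintro rfl
    simp at hTz

theorem IsSchreierSingular.isStrictlySingular {T : X →L[𝕜] Y} (hT : IsSchreierSingular φ ξ T) :
    IsStrictlySingular T := by
  intro Z hZ ε hε
  obtain ⟨x, hx, hxZ⟩ := exists_isBasicSequence_of_not_finiteDimensional Z hZ
  obtain ⟨F, -, z, hz, hz0, hTz⟩ := hT (ε / 2) (half_pos hε) x hx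
  refine ⟨z, ?_, hTz.trans_lt ?_⟩
  · refine (Submodule.span_le.2 ?_) hz
    rintro _ ⟨i, -, rfl⟩
    exact hxZ i
  · have := norm_pos_iff.2 hz0
    gcongr
    exact half_lt_self hε

theorem isClosed_schreierSingular : IsClosed (schreierSingular φ ξ 𝕜 X Y) := by
  rw [← closure_subset_iff_isClosed]
  intro T hT ε hε x hx
  obtain ⟨S, hS, hTS⟩ := Metric.mem_closure_iff.1 hT (ε / 2) (half_pos hε)
  obtain ⟨F, hF, z, hz, hz0, hSz⟩ := hS (ε / 2) (half_pos hε) x hx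
  refine ⟨F, hF, z, hz, hz0, ?_⟩
  rw [dist_eq_norm] at hTS
  calc ‖T z‖ = ‖(T - S) z + S z‖ := by simp
    _ ≤ ‖(T - S) z‖ + ‖S z‖ := norm_add_le _ _
    _ ≤ ε / 2 * ‖z‖ + ε / 2 * ‖z‖ := add_le_add ((T - S).le_of_opNorm_le hTS.le z) hSz
    _ = ε * ‖z‖ := by ring

theorem IsSchreierSingular.comp_left {S : X →L[𝕜] Y} (hS : IsSchreierSingular φ ξ S)
    (T : Y →L[𝕜] W) : IsSchreierSingular φ ξ (T.comp S) := by
  intro ε hε x hx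
  obtain ⟨F, hF, z, hz, hz0, hSz⟩ := hS (ε / (‖T‖ + 1)) (by positivity) x hx
  refine ⟨F, hF, z, hz, hz0, ?_⟩
  calc ‖T (S z)‖ ≤ ‖T‖ * (ε / (‖T‖ + 1) * ‖z‖) := T.le_opNorm_of_le hSz
    _ ≤ (‖T‖ + 1) * (ε / (‖T‖ + 1) * ‖z‖) := by gcongr; linarith
    _ = ε * ‖z‖ := by field_simp

/-- Right composition. If `T` is small on some difference of two far terms of the normalized basic
sequence, this difference is the vector sought. Otherwise the images of suitable differences form
a basic sequence, to which the hypothesis on `S` applies; pairs of indices do not leave `𝒮_ξ`. -/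
theorem IsSchreierSingular.comp_right [CompleteSpace X] (hφ : IsLadderSystem φ) (hξ₁ : 1 ≤ ξ)
    (hξ : ξ < ω₁) {S : Y →L[𝕜] W} (hS : IsSchreierSingular φ ξ S) (T : X →L[𝕜] Y) :
    IsSchreierSingular φ ξ (S.comp T) := by
  classical
  intro ε hε x hx
  obtain ⟨K, hK, hxK⟩ := hx.exists_grunblumWith
  obtain ⟨N, hN⟩ := exists_forall_mem_schreierFamily_of_le hφ hξ₁ hξ
  obtain ⟨g, hg⟩ := substitutesInto_schreierFamily_pairs hφ hξ₁ hξ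
  set e : ℕ → X := fun n => ((‖x n‖⁻¹ : ℝ) : 𝕜) • x n with he
  have he1 : ∀ n, ‖e n‖ = 1 := fun n => by
    have := norm_pos_iff.2 (hx.ne_zero n)
    simp only [he, norm_smul, RCLike.norm_ofReal, abs_of_pos (inv_pos.2 this)]
    exact inv_mul_cancel₀ this.ne'
  have hemem : ∀ (s : Set ℕ), ∀ n ∈ s, e n ∈ Submodule.span 𝕜 (x '' s) := fun s n hn =>
    Submodule.smul_mem _ _ (Submodule.subset_span (Set.mem_image_of_mem x hn))
  have hsep : ∀ p q, p < q → 1 / K ≤ ‖e p - e q‖ := by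
    intro p q hpq
    have h1 := hxK (p + 1) (e p) (hemem _ p (by simp)) (-e q)
      (Submodule.neg_mem _ (hemem _ q (Set.mem_Ici.2 hpq)))
    rw [he1, ← sub_eq_add_neg] at h1
    rwa [div_le_iff₀' hK]
  set δ : ℝ := ε / (‖S‖ + 1) with hδ
  have hδ0 : 0 < δ := by positivity
  by_cases hcase : ∃ p q, N + 1 ≤ p ∧ p < q ∧ ‖T (e p - e q)‖ ≤ δ * ‖e p - e q‖
  · obtain ⟨p, q, hp, hpq, hle⟩ := hcase
    refine ⟨{p, q}, hN _ ?_ ?_, e p - e q, ?_, ?_, ?_⟩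
    · rw [schreierFamily_one]
      intro i hi
      have h2 : ({p, q} : Finset ℕ).card ≤ 2 := Finset.card_le_two
      rw [Finset.mem_insert, Finset.mem_singleton] at hi
      omega
    · intro i hi
      rw [Finset.mem_insert, Finset.mem_singleton] at hi
      omega
    · exact Submodule.sub_mem _ (hemem _ p (by simp)) (hemem _ q (by simp))
    · rw [← norm_pos_iff]
      exact (by positivity : 0 < 1 / K).trans_le (hsep p q hpq)
    · calc ‖S (T (e p - e q))‖ ≤ ‖S‖ * (δ * ‖e p - e q‖) := S.le_opNorm_of_le hle
        _ ≤ (‖S‖ + 1) * (δ * ‖e p - e q‖) := by gcongr; linarith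
        _ = ε * ‖e p - e q‖ := by rw [hδ]; field_simp
  · push Not at hcase
    have hlow : ∀ p q, N + 1 ≤ p → p < q → δ * (1 / K) ≤ ‖T (e p - e q)‖ := fun p q hp hpq =>
      (mul_le_mul_of_nonneg_left (hsep p q hpq) hδ0.le).trans (hcase p q hp hpq).le
    have hTe : ∀ n, ‖T (e n)‖ ≤ ‖T‖ := fun n => by simpa [he1] using T.le_opNorm (e n)
    obtain ⟨a, ha, hR⟩ := exists_isBasicSequence_comp (𝕜 := 𝕜)
      (fun a : ℕ × ℕ => T (e a.1 - e a.2))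
      (R := fun l a => g l.length ≤ a.1 ∧ a.1 < a.2 ∧ ∀ b ∈ l, b.2 < a.1) (by
        intro l E _ c hc
        obtain ⟨J, hJ⟩ := exists_finset_forall_norm_le_mul_norm_add E hc
        obtain ⟨η, hη, hd⟩ := hJ (δ * (1 / K)) (by positivity)
        obtain ⟨M, hM⟩ := l.exists_forall_lt_nat Prod.snd
        obtain ⟨p, q, hp, hpq, hpqJ⟩ :=
          exists_lt_forall_norm_apply_sub_le hTe J hη (max (N + 1) (max (g l.length) M))
        simp only [max_le_iff] at hp
        have hl := hlow p q hp.1 hpq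
        refine ⟨(p, q), ⟨hp.2.1, hpq, fun b hb => (hM b hb).trans_le hp.2.2⟩, ?_, ?_⟩
        · rw [← norm_pos_iff]
          exact (by positivity : 0 < δ * (1 / K)).trans_le hl
        · refine hd _ hl fun f hf => ?_
          rw [map_sub]
          exact hpqJ f hf)
    obtain ⟨F, hF, z, hz, hz0, hSz⟩ := hS (ε / (‖T‖ + 1)) (by positivity) _ ha
    have hG : IsSuccessive fun k => ({(a k).1, (a k).2} : Finset ℕ) := by
      refine ⟨fun k => by simp, fun k l hkl i hi j hj => ?_⟩
      have h1 := (hR l).2.2 (a k) (List.mem_map_of_mem (List.mem_range.2 hkl))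
      have h2 := (hR k).2.1
      have h3 := (hR l).2.1
      simp only [Finset.mem_insert, Finset.mem_singleton] at hi hj
      omega
    have hz' : z ∈ (Submodule.span 𝕜 (x '' (F.biUnion fun k => {(a k).1, (a k).2} :
        Finset ℕ))).map (T : X →ₗ[𝕜] Y) := by
      refine (Submodule.span_le.2 ?_) hz
      rintro _ ⟨k, hk, rfl⟩
      refine ⟨e (a k).1 - e (a k).2, Submodule.sub_mem _ (hemem _ _ ?_) (hemem _ _ ?_), rfl⟩
      · exact Finset.mem_coe.2 (Finset.mem_biUnion.2 ⟨k, hk, by simp⟩)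
      · exact Finset.mem_coe.2 (Finset.mem_biUnion.2 ⟨k, hk, by simp⟩)
    obtain ⟨w, hw, rfl⟩ := hz'
    refine ⟨_, hg _ hG (fun k => Finset.card_le_two) F hF fun k _ i hi => ?_, w, hw, ?_, ?_⟩
    · have h1 := hR k
      simp only [List.length_map, List.length_range] at h1
      simp only [Finset.mem_insert, Finset.mem_singleton] at hi
      omega
    · rintro rfl
      simp at hz0
    · calc ‖S (T w)‖ ≤ ε / (‖T‖ + 1) * ‖T w‖ := hSz
        _ ≤ ε / (‖T‖ + 1) * ((‖T‖ + 1) * ‖w‖) := by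
          gcongr
          exact (T.le_opNorm w).trans (by gcongr; linarith)
        _ = ε * ‖w‖ := by field_simp

/-- Sums. The hypothesis on `S` yields a block sequence on the span of which `S` is small, and the
hypothesis on `T` is applied to that block sequence. -/
theorem IsSchreierSingular.add [CompleteSpace X] (hφ : IsLadderSystem φ) (hξ : ξ < ω₁)
    (hζ : ζ < ω₁) {S T : X →L[𝕜] Y} (hS : IsSchreierSingular φ ξ S)
    (hT : IsSchreierSingular φ ζ T) : IsSchreierSingular φ (ξ + ζ) (S + T) := by
  classical
  intro ε hε x hx
  obtain ⟨K, hK, hxK⟩ := hx.exists_grunblumWith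
  obtain ⟨g, hg⟩ := substitutesInto_schreierFamily_add hφ hξ hζ
  set C : ℝ := K * (K + 1) with hC
  have hC0 : 0 < C := by positivity
  -- The terms `c k • z k` of a vector `w` in the span of the block sequence `z` have norm at most
  -- `C * ‖w‖`, so these bounds for `S` on the terms add up to `ε / 2 * ‖w‖`.
  have step : ∀ l : List (Finset ℕ × X), ∃ a : Finset ℕ × X,
      a.1 ∈ schreierFamily φ ξ ∧ (∀ i ∈ a.1, g l.length ≤ i) ∧
      (∀ b ∈ l, ∀ i ∈ b.1, ∀ j ∈ a.1, i < j) ∧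
      a.2 ∈ Submodule.span 𝕜 (x '' (a.1 : Set ℕ)) ∧ a.2 ≠ 0 ∧
      ‖S a.2‖ ≤ ε / (4 * C) * (1 / 2) ^ l.length * ‖a.2‖ := by
    intro l
    obtain ⟨M, hM⟩ := l.exists_forall_lt_nat fun b => b.1.sup id
    obtain ⟨F, hF, hNF, z, hz, hz0, hSz⟩ := hS.exists_far hφ hξ
      (ε := ε / (4 * C) * (1 / 2) ^ l.length) (by positivity) hx (max (g l.length) M)
    refine ⟨(F, z), hF, fun i hi => (le_max_left _ _).trans (hNF i hi), ?_, hz, hz0, hSz⟩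
    intro b hb i hi j hj
    have h1 : i ≤ b.1.sup id := Finset.le_sup (f := id) hi
    exact (h1.trans_lt (hM b hb)).trans_le ((le_max_right _ _).trans (hNF j hj))
  obtain ⟨a, ha⟩ := exists_seq_forall_list step
  simp only [List.length_map, List.length_range] at ha
  have hG : IsSuccessive fun k => (a k).1 := by
    refine ⟨fun k => ?_, fun k l hkl => ?_⟩
    · rw [Finset.nonempty_iff_ne_empty]
      intro h0
      have h1 := (ha k).2.2.2.1
      rw [h0] at h1
      exact (ha k).2.2.2.2.1 (by simpa using h1)
    · exact (ha l).2.2.1 (a k) (List.mem_map_of_mem (List.mem_range.2 hkl))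
  set z : ℕ → X := fun k => (a k).2 with hzdef
  have hzG : GrunblumWith 𝕜 K z := hxK.block hG fun k => (ha k).2.2.2.1
  obtain ⟨F, hF, w, hw, hw0, hTw⟩ := hT (ε / 2) (half_pos hε) z
    (hzG.isBasicSequence hK.le fun k => (ha k).2.2.2.2.1)
  refine ⟨_, hg _ hG (fun k => (ha k).1) F hF fun k _ => (ha k).2.1, w, ?_, hw0, ?_⟩
  · refine (Submodule.span_le.2 ?_) hw
    rintro _ ⟨k, hk, rfl⟩
    refine Submodule.span_mono (Set.image_mono fun i hi => ?_) (ha k).2.2.2.1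
    exact Finset.mem_coe.2 (Finset.mem_biUnion.2 ⟨k, hk, hi⟩)
  obtain ⟨c, hc⟩ : ∃ c : ℕ → 𝕜, ∑ k ∈ F, c k • z k = w := by
    obtain ⟨c, hcF, hc⟩ := (Finsupp.mem_span_image_iff_linearCombination 𝕜).1 hw
    refine ⟨c, ?_⟩
    rw [← hc, Finsupp.linearCombination_apply]
    refine (Finsupp.sum_of_support_subset c ?_ (fun i a => a • z i) ?_).symm
    · exact_mod_cast hcF
    · exact fun i _ => zero_smul 𝕜 (z i)
  have hterm : ∀ k ∈ F, ‖c k • z k‖ ≤ C * ‖w‖ := by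
    intro k hk
    rw [← Finset.add_sum_erase F _ hk] at hc
    rw [← hc]
    refine hzG.norm_smul_le hK.le (c k) (Submodule.sum_mem _ fun j hj => ?_)
    exact Submodule.smul_mem _ _ (Submodule.subset_span
      (Set.mem_image_of_mem z (Finset.ne_of_mem_erase hj)))
  have hSw : ‖S w‖ ≤ ε / 2 * ‖w‖ := by
    have hgeom : ∑ k ∈ F, (1 / 2 : ℝ) ^ k ≤ 2 := by
      exact (summable_geometric_two.sum_le_tsum F fun k _ => by positivity).trans_eq
        tsum_geometric_two
    calc ‖S w‖ = ‖∑ k ∈ F, c k • S (z k)‖ := by rw [← hc]; simp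
      _ ≤ ∑ k ∈ F, ‖c k • S (z k)‖ := norm_sum_le _ _
      _ ≤ ∑ k ∈ F, ε / (4 * C) * (C * ‖w‖) * (1 / 2) ^ k := by
        refine Finset.sum_le_sum fun k hk => ?_
        calc ‖c k • S (z k)‖ = ‖c k‖ * ‖S (z k)‖ := norm_smul _ _
          _ ≤ ‖c k‖ * (ε / (4 * C) * (1 / 2) ^ k * ‖z k‖) := by
            gcongr
            exact (ha k).2.2.2.2.2
          _ = ε / (4 * C) * ‖c k • z k‖ * (1 / 2) ^ k := by rw [norm_smul]; ring
          _ ≤ ε / (4 * C) * (C * ‖w‖) * (1 / 2) ^ k := by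
            gcongr
            exact hterm k hk
      _ = ε / (4 * C) * (C * ‖w‖) * ∑ k ∈ F, (1 / 2) ^ k := by rw [Finset.mul_sum]
      _ ≤ ε / (4 * C) * (C * ‖w‖) * 2 := by gcongr
      _ = ε / 2 * ‖w‖ := by field_simp; ring
  calc ‖(S + T) w‖ ≤ ‖S w‖ + ‖T w‖ := norm_add_le _ _
    _ ≤ ε * ‖w‖ := by linarith

end singular

theorem proposition2p3
    {𝕜 : Type*} [RCLike 𝕜]
    {X : Type*} [NormedAddCommGroup X] [NormedSpace 𝕜 X] [CompleteSpace X]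
    {Y : Type*} [NormedAddCommGroup Y] [NormedSpace 𝕜 Y] [CompleteSpace Y]
    (φ : Ordinal.{0} → ℕ → Ordinal.{0}) (hφ : IsLadderSystem φ)
    (ξ ζ : Ordinal.{0}) (hξ : 1 ≤ ξ) (hξ' : ξ < ω₁) (hζ : 1 ≤ ζ) (hζ' : ζ < ω₁) :
    (finitelyStrictlySingular 𝕜 X Y ⊆ schreierSingular φ ξ 𝕜 X Y ∧
      schreierSingular φ ξ 𝕜 X Y ⊆ strictlySingular 𝕜 X Y) ∧
    (ξ < ζ → schreierSingular φ ξ 𝕜 X Y ⊆ schreierSingular φ ζ 𝕜 X Y) ∧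
    IsClosed (schreierSingular φ ξ 𝕜 X X) ∧
    (∀ S ∈ schreierSingular φ ξ 𝕜 X X, ∀ T : X →L[𝕜] X,
      T.comp S ∈ schreierSingular φ ξ 𝕜 X X ∧ S.comp T ∈ schreierSingular φ ξ 𝕜 X X) ∧
    (∀ S ∈ schreierSingular φ ξ 𝕜 X X, ∀ T ∈ schreierSingular φ ζ 𝕜 X X,
      S + T ∈ schreierSingular φ (ξ + ζ) 𝕜 X X) ∧
    (∀ S ∈ schreierSingular φ ξ 𝕜 X X, ∀ T ∈ schreierSingular φ ξ 𝕜 X X,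
      S + T ∈ schreierSingular φ (ξ * 2) 𝕜 X X) := by
  refine ⟨⟨fun T hT => hT.isSchreierSingular hφ hξ hξ', fun T hT => hT.isStrictlySingular⟩,
    fun h T hT => hT.mono hφ h.le hζ', isClosed_schreierSingular,
    fun S hS T => ⟨hS.comp_left T, hS.comp_right hφ hξ hξ' T⟩,
    fun S hS T hT => hS.add hφ hξ' hζ' hT, fun S hS T hT => ?_⟩
  rw [← one_add_one_eq_two, mul_add, mul_one]
  exact hS.add hφ hξ' hξ' hT
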